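/- **Setting.** All rings are associative with unity and all modules are unital. Let $n>1$. An $n$-by-$n$ generalized matrix ring $R$ consists of all square arrays $[r_{ij}]_{1\le i,j\le n}$ with $r_{ij}\in M_{ij}$, where $R_1,\dots,R_n$ are rings, each $M_{ij}$ is an $(R_i,R_j)$-bimodule, $M_{ii}=R_i$, and $(R_i,R_k)$-bimodule homomorphisms $\theta_{ijk}:M_{ij}\otimes_{R_j}M_{jk}\to M_{ik}$, written $xy=\theta_{ijk}(x\otimes y)$, are given for all $i,j,k$, such that $\theta_{iij}$ and $\theta_{ijj}$ are the scalar multiplications and $(xy)z=x(yz)$ for all $x\in M_{ij}$, $y\in M_{jk}$, $z\in M_{kl}$ and all $i,j,k,l$. Addition is componentwise and multiplication is row-column multiplication. Let $\mathcal T_n$ be the class of those $n$-by-$n$ generalized matrix rings with $\theta_{iji}=0$ for all $i\neq j$, and let $\mathcal D(R)=\{[r_{ij}]\in R: r_{ij}=0\text{ for all }i\ne j\}$ be the diagonal subring. For a ring $A$ with Jacobson radical $J=\mathcal J(A)$: $A$ is *semilocal* if $A/J$ is semisimple artinian; *semiperfect* if it is semilocal and every idempotent of $A/J$ lifts to an idempotent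 of $A$; *left* (resp. *right*) *perfect* if it is semilocal and for every sequence $a_1,a_2,\dots$ in $J$ there is an $m$ with $a_1a_2\cdots a_m=0$ (resp. $a_m\cdots a_2a_1=0$); *semiprimary* if it is semilocal and $J$ is nilpotent; and $A$ has *bounded index (of nilpotence)* if there is a positive integer $k$ with $x^k=0$ for every nilpotent $x\in A$. **Corollary 2.6.** Let $R\in\mathcal T_n$ with $n>1$. Then $\mathcal D(R)$ satisfies each of the following conditions if and only if $R$ does so: 1. semilocal; 2. semiperfect; 3. left perfect (and likewise: right perfect); 4. semiprimary; 5. bounded index (of nilpotence). -/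

import Mathlib

open MulOpposite

universe u v

/-- The data of an `n`-by-`n` generalized (formal) matrix ring: rings `R i`, bimodules `M i j` over
`(R i, R j)` with `M i i = R i` (the identification is `diag i`), and bimodule homomorphisms
`θ i j k` from the tensor product of `M i j` and `M j k` over `R j` to `M i k`, satisfying the
associativity relation. A right action of `R j` is an action of `(R j)ᵐᵒᵖ`, and a homomorphism out
of the tensor product over `R j` is given as a biadditive map that is balanced over `R j`. -/
structure GenMatrixData (n : ℕ) where
  /-- The diagonal rings. -/
  R : Fin n → Type u
  /-- The entries in position `(i, j)`. -/
  M : Fin n → Fin n → Type v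
  [ring : ∀ i, Ring (R i)]
  [addCommGroup : ∀ i j, AddCommGroup (M i j)]
  [leftModule : ∀ i j, Module (R i) (M i j)]
  [rightModule : ∀ i j, Module (R j)ᵐᵒᵖ (M i j)]
  [bimodule : ∀ i j, SMulCommClass (R i) (R j)ᵐᵒᵖ (M i j)]
  /-- The identification of `R i` with `M i i`, as `(R i, R i)`-bimodules. -/
  diag : ∀ i, R i ≃+ M i i
  diag_mul_left : ∀ i (r s : R i), diag i (r * s) = r • diag i s
  diag_mul_right : ∀ i (r s : R i), diag i (r * s) = op s • diag i r
  /-- The bimodule homomorphisms, written on elementary tensors. -/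
  θ : ∀ i j k, M i j →+ M j k →+ M i k
  θ_balanced : ∀ i j k (x : M i j) (r : R j) (y : M j k),
    θ i j k (op r • x) y = θ i j k x (r • y)
  θ_smul_left : ∀ i j k (r : R i) (x : M i j) (y : M j k),
    θ i j k (r • x) y = r • θ i j k x y
  θ_smul_right : ∀ i j k (x : M i j) (y : M j k) (r : R k),
    θ i j k x (op r • y) = op r • θ i j k x y
  /-- `θ i i k` is the left scalar multiplication. -/
  θ_diag_left : ∀ i k (r : R i) (y : M i k), θ i i k (diag i r) y = r • y
  /-- `θ i k k` is the right scalar multiplication. -/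
  θ_diag_right : ∀ i k (x : M i k) (r : R k), θ i k k x (diag k r) = op r • x
  θ_assoc : ∀ i j k l (x : M i j) (y : M j k) (z : M k l),
    θ i k l (θ i j k x y) z = θ i j l x (θ j k l y z)

namespace GenMatrixData

attribute [instance] ring addCommGroup leftModule rightModule bimodule

variable {n : ℕ} (G : GenMatrixData.{u, v} n)

/-- The elements of the generalized matrix ring: the square arrays with `(i, j)`-entry
in `M i j`. -/
def Mat : Type v := ∀ i j, G.M i j

instance : AddCommGroup G.Mat := inferInstanceAs (AddCommGroup (∀ i j, G.M i j))

/-- Row-column multiplication. -/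
instance : Mul G.Mat := ⟨fun x y i j => ∑ k, G.θ i k j (x i k) (y k j)⟩

/-- The identity matrix. -/
instance : One G.Mat := ⟨fun i => Pi.single i (G.diag i 1)⟩

variable {G}

theorem Mat.ext {x y : G.Mat} (h : ∀ i j, x i j = y i j) : x = y :=
  funext fun i => funext fun j => h i j

theorem Mat.add_apply (x y : G.Mat) (i j : Fin n) : (x + y) i j = x i j + y i j := rfl

theorem Mat.zero_apply (i j : Fin n) : (0 : G.Mat) i j = 0 := rfl

theorem Mat.neg_apply (x : G.Mat) (i j : Fin n) : (-x) i j = -x i j := rfl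

theorem Mat.mul_apply (x y : G.Mat) (i j : Fin n) :
    (x * y) i j = ∑ k, G.θ i k j (x i k) (y k j) := rfl

theorem Mat.one_apply_self (i : Fin n) : (1 : G.Mat) i i = G.diag i 1 :=
  Pi.single_eq_same (M := G.M i) i _

theorem Mat.one_apply_ne {i j : Fin n} (h : i ≠ j) : (1 : G.Mat) i j = 0 :=
  Pi.single_eq_of_ne (M := G.M i) h.symm _

instance : Ring G.Mat :=
  { (inferInstance : AddCommGroup G.Mat), (inferInstance : Mul G.Mat),
    (inferInstance : One G.Mat) with
    left_distrib := fun a b c => Mat.ext fun i j => by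
      simp only [Mat.mul_apply, Mat.add_apply, map_add, Finset.sum_add_distrib]
    right_distrib := fun a b c => Mat.ext fun i j => by
      simp only [Mat.mul_apply, Mat.add_apply, map_add, AddMonoidHom.add_apply,
        Finset.sum_add_distrib]
    zero_mul := fun a => Mat.ext fun i j => by
      simp only [Mat.mul_apply, Mat.zero_apply, map_zero, AddMonoidHom.zero_apply,
        Finset.sum_const_zero]
    mul_zero := fun a => Mat.ext fun i j => by
      simp only [Mat.mul_apply, Mat.zero_apply, map_zero, Finset.sum_const_zero]
    mul_assoc := fun a b c => Mat.ext fun i j => by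
      simp only [Mat.mul_apply, map_sum, AddMonoidHom.finsetSum_apply, G.θ_assoc]
      exact Finset.sum_comm
    one_mul := fun a => Mat.ext fun i j => by
      rw [Mat.mul_apply, Finset.sum_eq_single i]
      · rw [Mat.one_apply_self, G.θ_diag_left, one_smul]
      · intro k _ hk
        rw [Mat.one_apply_ne hk.symm, map_zero, AddMonoidHom.zero_apply]
      · intro h
        exact absurd (Finset.mem_univ i) h
    mul_one := fun a => Mat.ext fun i j => by
      rw [Mat.mul_apply, Finset.sum_eq_single j]
      · rw [Mat.one_apply_self, G.θ_diag_right, op_one, one_smul]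
      · intro k _ hk
        rw [Mat.one_apply_ne hk, map_zero]
      · intro h
        exact absurd (Finset.mem_univ j) h }

variable (G)

/-- The class `𝒯ₙ`: the homomorphism `θ i j i` vanishes for all `i ≠ j`. -/
def IsT : Prop := ∀ i j, i ≠ j → ∀ (x : G.M i j) (y : G.M j i), G.θ i j i x y = 0

/-- The diagonal ring: the subring of the arrays whose off-diagonal entries vanish. -/
def diagonalRing : Subring G.Mat where
  carrier := {x | ∀ i j, i ≠ j → x i j = 0}
  zero_mem' := fun _ _ _ => rfl
  one_mem' := fun _ _ h => Mat.one_apply_ne h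
  add_mem' := fun {a b} ha hb i j h => by rw [Mat.add_apply, ha i j h, hb i j h, add_zero]
  neg_mem' := fun {a} ha i j h => by rw [Mat.neg_apply, ha i j h, neg_zero]
  mul_mem' := fun {a b} ha hb i j h => by
    rw [Mat.mul_apply]
    refine Finset.sum_eq_zero fun k _ => ?_
    by_cases hk : i = k
    · subst hk
      rw [hb i j h, map_zero]
    · rw [ha i k hk, map_zero, AddMonoidHom.zero_apply]

end GenMatrixData

section RingProperties

variable (A : Type*) [Ring A]

/-- A ring is semilocal if it is semisimple (artinian) modulo its Jacobson radical. -/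
def IsSemilocalRing : Prop := IsSemisimpleRing (A ⧸ Ring.jacobson A)

/-- A ring is semiperfect if it is semilocal and idempotents lift modulo its Jacobson radical. -/
def IsSemiperfectRing : Prop :=
  IsSemilocalRing A ∧ ∀ a : A ⧸ Ring.jacobson A, IsIdempotentElem a →
    ∃ e : A, IsIdempotentElem e ∧ Ideal.Quotient.mk (Ring.jacobson A) e = a

variable {A} in
/-- `S` is left `T`-nilpotent: for all `a₀, a₁, … ∈ S` some product `a₀ a₁ ⋯ aₘ₋₁` vanishes. -/
def IsLeftTNilpotent (S : Set A) : Prop :=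
  ∀ a : ℕ → A, (∀ i, a i ∈ S) → ∃ m : ℕ, ((List.range m).map a).prod = 0

variable {A} in
/-- `S` is right `T`-nilpotent: for all `a₀, a₁, … ∈ S` some product `aₘ₋₁ ⋯ a₁ a₀` vanishes. -/
def IsRightTNilpotent (S : Set A) : Prop :=
  ∀ a : ℕ → A, (∀ i, a i ∈ S) → ∃ m : ℕ, ((List.range m).map a).reverse.prod = 0

/-- A ring is left perfect if it is semilocal with left `T`-nilpotent Jacobson radical. -/
def IsLeftPerfectRing : Prop :=
  IsSemilocalRing A ∧ IsLeftTNilpotent (Ring.jacobson A : Set A)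

/-- A ring is right perfect if it is semilocal with right `T`-nilpotent Jacobson radical. -/
def IsRightPerfectRing : Prop :=
  IsSemilocalRing A ∧ IsRightTNilpotent (Ring.jacobson A : Set A)

/-- A ring has bounded index (of nilpotence) if some fixed positive power kills every nilpotent
element. -/
def HasBoundedIndex : Prop := ∃ k : ℕ, 0 < k ∧ ∀ x : A, IsNilpotent x → x ^ k = 0

end RingProperties

/-! Since every `θ i j i` with `i ≠ j` vanishes, projecting an array to its diagonal is a ring
homomorphism, split by the inclusion of the diagonal ring. A product of `n` arrays from its kernel
is zero: its entries are sums over paths with `n` proper steps, such a path revisits an index, and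
by associativity a closed detour factors through some `θ i j i`. `killedBy` makes this pigeonhole
argument inductive (`IsT.list_prod_eq_zero`). All the conditions then transfer along a split
surjection with nilpotent kernel: the kernel lies in the radical, so the rings agree modulo their
radicals, and nilpotence is gained or lost only up to `n` blocks. -/

section ListProducts

/-! ### Nilpotent ideals through products of lists. -/

variable {A : Type*} [Ring A]

/-- An ideal has vanishing `m`-th power iff all `m`-fold products of its elements vanish. -/
theorem Ideal.pow_eq_bot_iff_forall_list_prod (I : Ideal A) (m : ℕ) :
    I ^ m = ⊥ ↔ ∀ l : List A, (∀ x ∈ l, x ∈ I) → l.length = m → l.prod = 0 := by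
  constructor
  · rintro h l hl rfl
    suffices H : ∀ (l : List A), (∀ x ∈ l, x ∈ I) → l.prod ∈ I ^ l.length by
      have := H l hl
      rwa [h, Ideal.mem_bot] at this
    intro l
    induction l using List.reverseRecOn with
    | nil =>
      intro _
      rw [List.length_nil, Submodule.pow_zero, Ideal.one_eq_top]
      exact Submodule.mem_top
    | append_singleton l a ih =>
      intro hl
      rw [List.prod_append, List.prod_singleton, List.length_append, List.length_singleton,
        Submodule.pow_succ]
      exact Ideal.mul_mem_mul (ih fun x hx => hl x (by simp [hx])) (hl a (by simp))
  · intro h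
    -- Factors of `I ^ k` are peeled off on the right one at a time; `l` is the suffix already
    -- peeled.
    have key : ∀ (k : ℕ) (l : List A), (∀ x ∈ l, x ∈ I) → l.length + k = m →
        ∀ x ∈ I ^ k, x * l.prod = 0 := by
      intro k
      induction k with
      | zero =>
        intro l hl hm x _
        rw [h l hl (by omega), mul_zero]
      | succ k ih =>
        intro l hl hm x hx
        rw [Submodule.pow_succ] at hx
        refine Submodule.mul_induction_on hx (fun y hy z hz => ?_) fun y z hy hz => ?_
        · rw [mul_assoc, ← List.prod_cons]
          exact ih (z :: l) (by simpa [hz] using hl) (by simp only [List.length_cons]; omega) y hy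
        · rw [add_mul, hy, hz, add_zero]
    refine eq_bot_iff.mpr fun x hx => ?_
    simpa using key m [] (by simp) (by simp) x hx

theorem Ideal.isNilpotent_iff_exists_forall_list_prod (I : Ideal A) :
    IsNilpotent I ↔
      ∃ m : ℕ, ∀ l : List A, (∀ x ∈ l, x ∈ I) → l.length = m → l.prod = 0 :=
  exists_congr fun m => I.pow_eq_bot_iff_forall_list_prod m

end ListProducts

/-! ### Transfer along a surjection with nilpotent kernel. -/

section NilpotentKernel

variable {A B : Type*} [Ring A] [Ring B] {f : A →+* B} {m : ℕ}

/-- For `x` in the kernel every `y * x` is nilpotent, so `1 + y * x` is a unit. -/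
theorem ker_le_jacobson_of_forall_list_prod
    (hN : ∀ l : List A, (∀ x ∈ l, f x = 0) → l.length = m → l.prod = 0) :
    RingHom.ker f ≤ Ring.jacobson A := by
  intro x hx
  rw [RingHom.mem_ker] at hx
  rw [← Ideal.jacobson_bot, Ideal.mem_jacobson_iff]
  intro y
  have hnil : IsNilpotent (y * x) := by
    refine ⟨m, ?_⟩
    rw [← List.prod_replicate]
    refine hN _ (fun z hz => ?_) (List.length_replicate ..)
    rw [List.eq_of_mem_replicate hz, map_mul, hx, mul_zero]
  obtain ⟨u, hu⟩ := hnil.isUnit_one_add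
  refine ⟨↑u⁻¹, ?_⟩
  have h : (↑u⁻¹ : A) * (1 + y * x) = 1 := by rw [← hu, Units.inv_mul]
  rw [Ideal.mem_bot, sub_eq_zero, mul_assoc, ← h, mul_add, mul_one, add_comm]

/-- All maximal left ideals of `A` contain the kernel, so they correspond to those of `B`. -/
theorem apply_mem_jacobson_iff (hf : Function.Surjective f)
    (hker : RingHom.ker f ≤ Ring.jacobson A) (x : A) :
    f x ∈ Ring.jacobson B ↔ x ∈ Ring.jacobson A := by
  have : RingHomSurjective f := ⟨hf⟩
  have h := Module.comap_jacobson_of_ker_le (f := f.toSemilinearMap) hf hker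
  exact SetLike.ext_iff.mp h x

theorem exists_quotient_jacobson_equiv (hf : Function.Surjective f)
    (hker : RingHom.ker f ≤ Ring.jacobson A) :
    ∃ e : (A ⧸ Ring.jacobson A) ≃+* (B ⧸ Ring.jacobson B),
      ∀ x, e (Ideal.Quotient.mk _ x) = Ideal.Quotient.mk _ (f x) := by
  have hmem := apply_mem_jacobson_iff hf hker
  let φ : (A ⧸ Ring.jacobson A) →+* (B ⧸ Ring.jacobson B) :=
    Ideal.Quotient.lift _ ((Ideal.Quotient.mk (Ring.jacobson B)).comp f) fun x hx =>
      Ideal.Quotient.eq_zero_iff_mem.mpr ((hmem x).mpr hx)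
  refine ⟨RingEquiv.ofBijective φ ⟨?_, ?_⟩, fun x => rfl⟩
  · rw [injective_iff_map_eq_zero]
    intro a ha
    obtain ⟨x, rfl⟩ := Ideal.Quotient.mk_surjective a
    exact Ideal.Quotient.eq_zero_iff_mem.mpr ((hmem x).mp (Ideal.Quotient.eq_zero_iff_mem.mp ha))
  · intro b
    obtain ⟨y, rfl⟩ := Ideal.Quotient.mk_surjective b
    obtain ⟨x, rfl⟩ := hf y
    exact ⟨Ideal.Quotient.mk _ x, rfl⟩

theorem isSemilocalRing_iff_of_ker_le_jacobson (hf : Function.Surjective f)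
    (hker : RingHom.ker f ≤ Ring.jacobson A) : IsSemilocalRing B ↔ IsSemilocalRing A := by
  obtain ⟨e, -⟩ := exists_quotient_jacobson_equiv hf hker
  exact e.isSemisimpleRing_iff.symm

/-- Once the quotients are identified, `s` and `f` carry idempotent lifts across; the section makes
lifting modulo the kernel unnecessary. -/
theorem isSemiperfectRing_iff_of_section {s : B →+* A} (hs : ∀ b, f (s b) = b)
    (hker : RingHom.ker f ≤ Ring.jacobson A) :
    IsSemiperfectRing B ↔ IsSemiperfectRing A := by
  have hf : Function.Surjective f := fun b => ⟨s b, hs b⟩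
  obtain ⟨e, he⟩ := exists_quotient_jacobson_equiv hf hker
  refine and_congr (isSemilocalRing_iff_of_ker_le_jacobson hf hker) ⟨fun h a ha => ?_,
    fun h b hb => ?_⟩
  · obtain ⟨b, hb, hba⟩ := h (e a) (ha.map e)
    refine ⟨s b, hb.map s, e.injective ?_⟩
    rw [he, hs, hba]
  · obtain ⟨a, ha, hab⟩ := h (e.symm b) (hb.map e.symm)
    refine ⟨f a, ha.map f, ?_⟩
    rw [← he, hab, e.apply_symm_apply]

/-- T-nilpotence in `B`, applied to successive tails, cuts a sequence in the radical of `A` into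
consecutive blocks with product in the kernel; `m` blocks multiply to zero. Conversely, a sequence
in `B` is moved to `A` by `s`. -/
theorem isLeftPerfectRing_iff_of_section {s : B →+* A} (hs : ∀ b, f (s b) = b)
    (hN : ∀ l : List A, (∀ x ∈ l, f x = 0) → l.length = m → l.prod = 0) :
    IsLeftPerfectRing B ↔ IsLeftPerfectRing A := by
  have hf : Function.Surjective f := fun b => ⟨s b, hs b⟩
  have hker := ker_le_jacobson_of_forall_list_prod hN
  have hmem := apply_mem_jacobson_iff hf hker
  refine and_congr (isSemilocalRing_iff_of_ker_le_jacobson hf hker) ⟨fun h a ha => ?_,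
    fun h b hb => ?_⟩
  · have key : ∀ k : ℕ, ∃ (p : ℕ) (l : List A), (∀ x ∈ l, f x = 0) ∧ l.length = k ∧
        ((List.range p).map a).prod = l.prod := by
      intro k
      induction k with
      | zero => exact ⟨0, [], by simp, rfl, by simp⟩
      | succ k ih =>
        obtain ⟨p, l, hl, hlen, hprod⟩ := ih
        obtain ⟨q, hq⟩ := h (fun i => f (a (p + i))) fun i => (hmem _).mpr (ha _)
        refine ⟨p + q, l ++ [((List.range q).map fun i => a (p + i)).prod], ?_, by simp [hlen], ?_⟩
        · intro x hx
          rcases List.mem_append.mp hx with hx | hx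
          · exact hl x hx
          · rw [List.mem_singleton.mp hx, map_list_prod, List.map_map]
            exact hq
        · rw [List.range_add, List.map_append, List.prod_append, hprod, List.prod_append,
            List.prod_singleton, List.map_map]
          rfl
    obtain ⟨p, l, hl, hlen, hprod⟩ := key m
    exact ⟨p, hprod.trans (hN l hl hlen)⟩
  · obtain ⟨p, hp⟩ := h (fun i => s (b i)) fun i => (hmem _).mp ((hs (b i)).symm ▸ hb i)
    refine ⟨p, ?_⟩
    have := congrArg f hp
    rw [map_list_prod, List.map_map, map_zero] at this
    simpa [Function.comp_def, hs] using this

theorem isRightPerfectRing_iff_of_section {s : B →+* A} (hs : ∀ b, f (s b) = b)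
    (hN : ∀ l : List A, (∀ x ∈ l, f x = 0) → l.length = m → l.prod = 0) :
    IsRightPerfectRing B ↔ IsRightPerfectRing A := by
  have hf : Function.Surjective f := fun b => ⟨s b, hs b⟩
  have hker := ker_le_jacobson_of_forall_list_prod hN
  have hmem := apply_mem_jacobson_iff hf hker
  refine and_congr (isSemilocalRing_iff_of_ker_le_jacobson hf hker) ⟨fun h a ha => ?_,
    fun h b hb => ?_⟩
  · have key : ∀ k : ℕ, ∃ (p : ℕ) (l : List A), (∀ x ∈ l, f x = 0) ∧ l.length = k ∧
        ((List.range p).map a).reverse.prod = l.prod := by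
      intro k
      induction k with
      | zero => exact ⟨0, [], by simp, rfl, by simp⟩
      | succ k ih =>
        obtain ⟨p, l, hl, hlen, hprod⟩ := ih
        obtain ⟨q, hq⟩ := h (fun i => f (a (p + i))) fun i => (hmem _).mpr (ha _)
        -- In reversed order the later block stands on the left.
        refine ⟨p + q, ((List.range q).map fun i => a (p + i)).reverse.prod :: l, ?_,
          by simp [hlen], ?_⟩
        · intro x hx
          rcases List.mem_cons.mp hx with rfl | hx
          · rw [map_list_prod, List.map_reverse, List.map_map]
            exact hq
          · exact hl x hx
        · rw [List.range_add, List.map_append, List.reverse_append, List.prod_append, hprod,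
            List.prod_cons, List.map_map]
          rfl
    obtain ⟨p, l, hl, hlen, hprod⟩ := key m
    exact ⟨p, hprod.trans (hN l hl hlen)⟩
  · obtain ⟨p, hp⟩ := h (fun i => s (b i)) fun i => (hmem _).mp ((hs (b i)).symm ▸ hb i)
    refine ⟨p, ?_⟩
    have := congrArg f hp
    rw [map_list_prod, List.map_reverse, List.map_map, map_zero] at this
    simpa [Function.comp_def, hs] using this

/-- If `k`-fold products in the radical of `B` vanish, those in the radical of `A` lie in the
kernel, so `m * k` factors suffice in `A`. -/
theorem isSemiprimaryRing_iff_of_section {s : B →+* A} (hs : ∀ b, f (s b) = b)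
    (hN : ∀ l : List A, (∀ x ∈ l, f x = 0) → l.length = m → l.prod = 0) :
    IsSemiprimaryRing B ↔ IsSemiprimaryRing A := by
  have hf : Function.Surjective f := fun b => ⟨s b, hs b⟩
  have hker := ker_le_jacobson_of_forall_list_prod hN
  have hmem := apply_mem_jacobson_iff hf hker
  rw [isSemiprimaryRing_iff, isSemiprimaryRing_iff,
    Ideal.isNilpotent_iff_exists_forall_list_prod, Ideal.isNilpotent_iff_exists_forall_list_prod]
  refine and_congr (isSemilocalRing_iff_of_ker_le_jacobson hf hker) ⟨?_, ?_⟩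
  · rintro ⟨k, hk⟩
    have key : ∀ (j : ℕ) (l : List A), (∀ x ∈ l, x ∈ Ring.jacobson A) → l.length = j * k →
        ∃ l' : List A, (∀ x ∈ l', f x = 0) ∧ l'.length = j ∧ l.prod = l'.prod := by
      intro j
      induction j with
      | zero =>
        intro l _ hlen
        rw [zero_mul, List.length_eq_zero_iff] at hlen
        exact ⟨[], by simp, rfl, by rw [hlen]⟩
      | succ j ih =>
        intro l hl hlen
        rw [Nat.succ_mul] at hlen
        obtain ⟨l', hl', hlen', hprod⟩ := ih (l.drop k)
          (fun x hx => hl x (List.mem_of_mem_drop hx)) (by rw [List.length_drop]; omega)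
        refine ⟨(l.take k).prod :: l', ?_, by simp [hlen'], ?_⟩
        · intro x hx
          rcases List.mem_cons.mp hx with rfl | hx
          · rw [map_list_prod]
            refine hk _ (fun y hy => ?_) (by rw [List.length_map, List.length_take]; omega)
            obtain ⟨z, hz, rfl⟩ := List.mem_map.mp hy
            exact (hmem z).mpr (hl z (List.mem_of_mem_take hz))
          · exact hl' x hx
        · rw [List.prod_cons, ← hprod, ← List.prod_append, List.take_append_drop]
    refine ⟨m * k, fun l hl hlen => ?_⟩
    obtain ⟨l', hl', hlen', hprod⟩ := key m l hl hlen
    exact hprod.trans (hN l' hl' hlen')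
  · rintro ⟨k, hk⟩
    refine ⟨k, fun l hl hlen => ?_⟩
    have := congrArg f (hk (l.map s) (fun x hx => ?_) (by rw [List.length_map, hlen]))
    · rw [map_list_prod, List.map_map, map_zero] at this
      simpa [Function.comp_def, hs] using this
    · obtain ⟨z, hz, rfl⟩ := List.mem_map.mp hx
      exact (hmem _).mp ((hs z).symm ▸ hl z hz)

theorem hasBoundedIndex_iff_of_section {s : B →+* A} (hs : ∀ b, f (s b) = b)
    (hN : ∀ l : List A, (∀ x ∈ l, f x = 0) → l.length = m → l.prod = 0) :
    HasBoundedIndex B ↔ HasBoundedIndex A := by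
  constructor
  · rintro ⟨k, hk0, hk⟩
    -- The exponent `k * m` already kills `x`; the extra `k` keeps it positive when `m = 0`.
    refine ⟨k * (m + 1), by positivity, fun x hx => ?_⟩
    have hfx : f (x ^ k) = 0 := by rw [map_pow, hk _ (hx.map f)]
    rw [pow_mul, pow_succ, ← List.prod_replicate,
      hN _ (fun z hz => by rw [List.eq_of_mem_replicate hz, hfx]) (List.length_replicate ..),
      zero_mul]
  · rintro ⟨k, hk0, hk⟩
    refine ⟨k, hk0, fun x hx => ?_⟩
    rw [← hs (x ^ k), map_pow, hk _ (hx.map s), map_zero]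

end NilpotentKernel

/-! ### Pigeonhole on paths of indices. -/

namespace GenMatrixData

variable {n : ℕ} {G : GenMatrixData.{u, v} n}

/-- The elements of `M i j` whose products with all of the `M j k`, `k ∈ S`, vanish. -/
def rightKilled (G : GenMatrixData.{u, v} n) (S : Finset (Fin n)) (i j : Fin n) :
    AddSubgroup (G.M i j) where
  carrier := {v | ∀ k ∈ S, ∀ y : G.M j k, G.θ i j k v y = 0}
  zero_mem' := fun k _ y => by rw [map_zero, AddMonoidHom.zero_apply]
  add_mem' := fun {a b} ha hb k hk y => by
    rw [map_add, AddMonoidHom.add_apply, ha k hk y, hb k hk y, add_zero]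
  neg_mem' := fun {a} ha k hk y => by
    rw [map_neg, AddMonoidHom.neg_apply, ha k hk y, neg_zero]

theorem eq_zero_of_mem_rightKilled {S : Finset (Fin n)} {i j : Fin n} {v : G.M i j}
    (hv : v ∈ G.rightKilled S i j) (hj : j ∈ S) : v = 0 := by
  have h := hv j hj (G.diag j 1)
  rwa [G.θ_diag_right, op_one, one_smul] at h

/-- Reassociate `(v x) y = v (x y)`: for `y` ending at `j` the factor `x y` is a value of `θ j k j`,
and for `y` ending in `S` it is killed by `v`. So `S` records the indices the path has left. -/
theorem IsT.θ_mem_rightKilled (hG : G.IsT) {S : Finset (Fin n)} {i j k : Fin n} (hjk : j ≠ k)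
    {v : G.M i j} (hv : v ∈ G.rightKilled S i j) (x : G.M j k) :
    G.θ i j k v x ∈ G.rightKilled (insert j S) i k := by
  intro l hl y
  rw [G.θ_assoc]
  rcases Finset.mem_insert.mp hl with rfl | hl
  · rw [hG l k hjk, map_zero]
  · exact hv l hl _

/-- The sum of the `rightKilled S i j` over the `m`-element sets `S`. -/
def killedBy (G : GenMatrixData.{u, v} n) (m : ℕ) (i j : Fin n) : AddSubgroup (G.M i j) :=
  ⨆ S : {S : Finset (Fin n) // S.card = m}, G.rightKilled S.1 i j

/-- On each summand, either `j` is new and the set grows by one, or `j` was visited before and the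
element is already zero. -/
theorem IsT.θ_mem_killedBy_succ (hG : G.IsT) {m : ℕ} {i j k : Fin n} (hjk : j ≠ k)
    {v : G.M i j} (hv : v ∈ G.killedBy m i j) (x : G.M j k) :
    G.θ i j k v x ∈ G.killedBy (m + 1) i k := by
  have hle : G.killedBy m i j ≤ (G.killedBy (m + 1) i k).comap ((G.θ i j k).flip x) := by
    refine iSup_le fun S w hw => ?_
    rw [AddSubgroup.mem_comap, AddMonoidHom.flip_apply]
    by_cases hj : j ∈ S.1
    · rw [eq_zero_of_mem_rightKilled hw hj, map_zero, AddMonoidHom.zero_apply]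
      exact zero_mem _
    · exact le_iSup (fun T : {T : Finset (Fin n) // T.card = m + 1} => G.rightKilled T.1 i k)
        ⟨insert j S.1, by rw [Finset.card_insert_of_notMem hj, S.2]⟩
        (hG.θ_mem_rightKilled hjk hw x)
  exact hle hv

theorem killedBy_card (i j : Fin n) : G.killedBy n i j = ⊥ := by
  refine eq_bot_iff.mpr (iSup_le fun S v hv => ?_)
  have hS : S.1 = Finset.univ := Finset.card_eq_iff_eq_univ _ |>.mp (by rw [S.2, Fintype.card_fin])
  exact eq_zero_of_mem_rightKilled hv (hS ▸ Finset.mem_univ j)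

theorem killedBy_zero (i j : Fin n) : G.killedBy 0 i j = ⊤ := by
  refine eq_top_iff.mpr fun v _ => ?_
  refine le_iSup (fun S : {S : Finset (Fin n) // S.card = 0} => G.rightKilled S.1 i j)
    ⟨∅, rfl⟩ ?_
  intro k hk
  exact absurd hk (Finset.notMem_empty k)

/-! ### The diagonal projection and its nilpotent kernel. -/

/-- The array with the same diagonal as `x` and vanishing off-diagonal entries. -/
def diagonalPart (x : G.Mat) : G.Mat := fun i => Pi.single i (x i i)

theorem diagonalPart_apply_self (x : G.Mat) (i : Fin n) : diagonalPart x i i = x i i :=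
  Pi.single_eq_same (M := G.M i) i _

theorem diagonalPart_apply_ne (x : G.Mat) {i j : Fin n} (h : i ≠ j) : diagonalPart x i j = 0 :=
  Pi.single_eq_of_ne (M := G.M i) h.symm _

/-- Reduces each homomorphism law of `diagonalHom` to comparing diagonals, since the diagonal arrays
form a subring. -/
theorem eq_diagonalPart_iff {x y : G.Mat} :
    y = diagonalPart x ↔ (∀ i, y i i = x i i) ∧ y ∈ G.diagonalRing := by
  constructor
  · rintro rfl
    exact ⟨diagonalPart_apply_self x, fun i j h => diagonalPart_apply_ne x h⟩
  · rintro ⟨h1, h2⟩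
    refine Mat.ext fun i j => ?_
    by_cases h : i = j
    · subst h
      rw [h1, diagonalPart_apply_self]
    · rw [h2 i j h, diagonalPart_apply_ne x h]

theorem diagonalPart_mem (x : G.Mat) : diagonalPart x ∈ G.diagonalRing :=
  (eq_diagonalPart_iff.mp rfl).2

theorem IsT.mul_apply_self (hG : G.IsT) (x y : G.Mat) (i : Fin n) :
    (x * y) i i = G.θ i i i (x i i) (y i i) := by
  rw [Mat.mul_apply]
  exact Finset.sum_eq_single i (fun k _ hk => hG i k hk.symm _ _)
    fun h => absurd (Finset.mem_univ i) h

/-- The projection onto the diagonal is a ring homomorphism for the rings in `𝒯ₙ`. -/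
def IsT.diagonalHom (hG : G.IsT) : G.Mat →+* G.diagonalRing where
  toFun x := ⟨diagonalPart x, diagonalPart_mem x⟩
  map_one' := Subtype.ext (eq_diagonalPart_iff.mpr ⟨fun _ => rfl, one_mem _⟩).symm
  map_zero' := Subtype.ext (eq_diagonalPart_iff.mpr ⟨fun _ => rfl, zero_mem _⟩).symm
  map_add' x y := Subtype.ext (eq_diagonalPart_iff.mpr ⟨fun i => by
    rw [Mat.add_apply, Mat.add_apply, diagonalPart_apply_self, diagonalPart_apply_self],
    add_mem (diagonalPart_mem x) (diagonalPart_mem y)⟩).symm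
  map_mul' x y := Subtype.ext (eq_diagonalPart_iff.mpr ⟨fun i => by
    rw [hG.mul_apply_self, hG.mul_apply_self, diagonalPart_apply_self, diagonalPart_apply_self],
    mul_mem (diagonalPart_mem x) (diagonalPart_mem y)⟩).symm

theorem IsT.diagonalHom_subtype (hG : G.IsT) (d : G.diagonalRing) :
    hG.diagonalHom (G.diagonalRing.subtype d) = d :=
  Subtype.ext (eq_diagonalPart_iff.mpr ⟨fun _ => rfl, d.2⟩).symm

theorem IsT.apply_self_eq_zero_of_diagonalHom_eq_zero (hG : G.IsT) {x : G.Mat}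
    (hx : hG.diagonalHom x = 0) (i : Fin n) : x i i = 0 := by
  rw [← diagonalPart_apply_self x i]
  exact congrArg (fun d : G.diagonalRing => (d : G.Mat) i i) hx

/-- With zero diagonals only the terms `k ≠ j` survive, so each further factor is a proper step and
raises the `killedBy` level by one. -/
theorem IsT.list_prod_apply_mem_killedBy (hG : G.IsT) (l : List G.Mat)
    (hl : ∀ x ∈ l, ∀ i, x i i = 0) (i j : Fin n) : l.prod i j ∈ G.killedBy l.length i j := by
  induction l using List.reverseRecOn generalizing j with
  | nil => rw [List.length_nil, killedBy_zero]; exact AddSubgroup.mem_top _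
  | append_singleton l x ih =>
    rw [List.prod_append, List.prod_singleton, List.length_append, List.length_singleton,
      Mat.mul_apply]
    refine sum_mem fun k _ => ?_
    by_cases hkj : k = j
    · subst hkj
      rw [hl x (by simp) k, map_zero]
      exact zero_mem _
    · exact hG.θ_mem_killedBy_succ hkj (ih (fun y hy => hl y (by simp [hy])) k) _

theorem IsT.list_prod_eq_zero (hG : G.IsT) (l : List G.Mat)
    (hl : ∀ x ∈ l, hG.diagonalHom x = 0) (hlen : l.length = n) : l.prod = 0 :=
  Mat.ext fun i j => by
    have h := hG.list_prod_apply_mem_killedBy l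
      (fun x hx => hG.apply_self_eq_zero_of_diagonalHom_eq_zero (hl x hx)) i j
    rwa [hlen, killedBy_card, AddSubgroup.mem_bot] at h

end GenMatrixData

theorem corollary2p6 (n : ℕ) (hn : 1 < n) (G : GenMatrixData.{u, v} n) (hG : G.IsT) :
    (IsSemilocalRing G.diagonalRing ↔ IsSemilocalRing G.Mat) ∧
    (IsSemiperfectRing G.diagonalRing ↔ IsSemiperfectRing G.Mat) ∧
    (IsLeftPerfectRing G.diagonalRing ↔ IsLeftPerfectRing G.Mat) ∧
    (IsRightPerfectRing G.diagonalRing ↔ IsRightPerfectRing G.Mat) ∧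
    (IsSemiprimaryRing G.diagonalRing ↔ IsSemiprimaryRing G.Mat) ∧
    (HasBoundedIndex G.diagonalRing ↔ HasBoundedIndex G.Mat) := by
  have hs := hG.diagonalHom_subtype
  have hN := hG.list_prod_eq_zero
  have hker := ker_le_jacobson_of_forall_list_prod hN
  exact ⟨isSemilocalRing_iff_of_ker_le_jacobson (fun b => ⟨_, hs b⟩) hker,
    isSemiperfectRing_iff_of_section hs hker, isLeftPerfectRing_iff_of_section hs hN,
    isRightPerfectRing_iff_of_section hs hN, isSemiprimaryRing_iff_of_section hs hN,
    hasBoundedIndex_iff_of_section hs hN⟩
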